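/- Let $n\ge 2$ and let $M_{2,n}$ be the $2\times n$ Miura-ori crease pattern: a tessellation by two rows and $n$ columns of congruent (non-rectangular) parallelograms with a straight horizontal middle line crossed by zig-zags, whose creases are the edges shared by two parallelograms. A mountain-valley (MV) assignment $\mu$ gives each crease a value in $\{1,-1\}$ (mountain or valley); it is locally valid if every interior vertex, viewed by itself, folds flat without self-intersection with the given mountains and valleys. Flipping a face negates $\mu$ on all creases bordering that face; a face is flippable under a locally valid $\mu$ if the flipped assignment is again locally valid. The origami flip graph $\mathrm{OFG}(M_{2,n})$ has the locally valid MV assignments as vertices, two of them being adjacent when they differ by one face flip. Two MV assignments with the same flippable faces are called opposite if they have opposite values on every crease. Then any two opposite vertices of degree $2$ in $\mathrm{OFG}(M_{2,n})$ are connected by a path, and a shortest path between them in $\mathrm{OFG}(M_{2,n})$ has length exactly $\left\lceil \frac{n^2}{2}\right\rceil$. -/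

import Mathlib

noncomputable section

/-- The data of an origami crease pattern on which local flat-foldability and face flips depend:
its interior vertices, its creases (the edges interior to the paper), its faces, the
counterclockwise cyclic list of creases at every interior vertex, the sector angles at every
interior vertex, and the incidence between creases and faces. -/
structure CreasePattern where
  Vertex : Type
  Crease : Type
  Face : Type
  deg : Vertex → ℕ
  deg_neZero : ∀ x, NeZero (deg x)
  /-- The creases at the interior vertex `x`, in counterclockwise order. -/
  creaseAt : (x : Vertex) → Fin (deg x) → Crease
  /-- `sectorAt x i` is the angle at `x` from the `i`-th crease to the (cyclically) next one. -/
  sectorAt : (x : Vertex) → Fin (deg x) → ℝ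
  /-- `Borders e α`: the crease `e` lies on the boundary of the face `α`. -/
  Borders : Crease → Face → Prop

attribute [instance] CreasePattern.deg_neZero

/-- A flat folded state, without self-intersection, of a neighbourhood of a single vertex with
sector angles `ρ` and mountain (`1`) / valley (`-1`) assignment `μ`. Sector `i` lies between the
creases `i` and `i + 1` (cyclically), so crease `i` joins the sectors `i - 1` and `i`.
A small circle around the vertex is cut by the creases into arcs of lengths `ρ i`; folding along
all creases lays this closed curve flat, with the arcs running back and forth.
* `ε i` is `1` if the sector `i` keeps its upper side up, `-1` if it is turned over;
* `p i` is the position of the crease `i` along the folded curve (an angular coordinate);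
* `L i` is the height of the sector `i` in the stack of layers. -/
structure IsFlatFolding {d : ℕ} [NeZero d] (ρ : Fin d → ℝ) (μ : Fin d → ℤˣ)
    (ε : Fin d → ℤˣ) (p : Fin d → ℝ) (L : Fin d → ℤ) : Prop where
  /-- Every crease is folded: consecutive sectors have opposite sides up. -/
  turn : ∀ i, ε (i + 1) = -ε i
  /-- The folding map is isometric on every sector. -/
  isometric : ∀ i, p (i + 1) = p i + ((ε i : ℤ) : ℝ) * ρ i
  layer_injective : Function.Injective L
  /-- Mountains and valleys: at a valley crease the upper sides of the two sectors face each
  other, at a mountain crease their lower sides do. -/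
  parity : ∀ i, 0 < (μ i : ℤ) * (ε i : ℤ) * (L i - L (i - 1))
  /-- No sector passes through a crease: a sector that extends to both sides of the position of
  a crease is not layered between the two sectors which that crease joins. -/
  not_pierced : ∀ i j, p i ∈ Set.uIoo (p j) (p (j + 1)) → L j ∉ Set.uIoo (L (i - 1)) (L i)
  /-- No two creases cross: two creases at the same position whose sectors extend to the same
  side are nested or apart in the layer order, never interleaved. -/
  not_crossed : ∀ i j, i ≠ j → p i = p j → ε i = ε j →
    (L (j - 1) ∈ Set.uIoo (L (i - 1)) (L i) ↔ L j ∈ Set.uIoo (L (i - 1)) (L i))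

namespace CreasePattern

/-- A mountain-valley assignment: `1` is a mountain crease, `-1` is a valley crease. -/
abbrev MVAssignment (C : CreasePattern) : Type := C.Crease → ℤˣ

/-- An MV assignment is locally valid if every interior vertex, viewed by itself, folds flat
without self-intersection with the given mountains and valleys. -/
def LocallyValid (C : CreasePattern) (μ : C.MVAssignment) : Prop :=
  ∀ x : C.Vertex, ∃ (ε : Fin (C.deg x) → ℤˣ) (p : Fin (C.deg x) → ℝ) (L : Fin (C.deg x) → ℤ),
    IsFlatFolding (C.sectorAt x) (fun i => μ (C.creaseAt x i)) ε p L

open Classical in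
/-- The face flip of `α` under `μ`: reverse all the creases that border `α`. -/
def flip (C : CreasePattern) (μ : C.MVAssignment) (α : C.Face) : C.MVAssignment :=
  fun e => if C.Borders e α then -μ e else μ e

theorem flip_flip (C : CreasePattern) (μ : C.MVAssignment) (α : C.Face) :
    C.flip (C.flip μ α) α = μ := by
  funext e
  by_cases h : C.Borders e α <;> simp [flip, h]

/-- The vertices of the origami flip graph: the locally valid MV assignments. -/
abbrev ValidMV (C : CreasePattern) : Type := {μ : C.MVAssignment // C.LocallyValid μ}

/-- The origami flip graph: two distinct locally valid MV assignments are adjacent when they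
differ by one face flip. -/
def OFG (C : CreasePattern) : SimpleGraph C.ValidMV where
  Adj μ ν := μ ≠ ν ∧ ∃ α : C.Face, ν.1 = C.flip μ.1 α
  symm := ⟨fun μ ν h => ⟨h.1.symm, h.2.imp fun α hα => by rw [hα, flip_flip]⟩⟩
  loopless := ⟨fun _ h => h.1 rfl⟩

/-- The faces that are flippable under a locally valid MV assignment. -/
def flippableFaces (C : CreasePattern) (μ : C.ValidMV) : Set C.Face :=
  {α | C.LocallyValid (C.flip μ.1 α)}

/-- Two locally valid MV assignments with the same flippable faces are opposite if they have
opposite MV parities on all creases. -/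
def Opposite (C : CreasePattern) (μ ν : C.ValidMV) : Prop :=
  C.flippableFaces μ = C.flippableFaces ν ∧ ∀ e, ν.1 e = -μ.1 e

end CreasePattern

/-- The creases of the `m × n` Miura-ori, rows and columns being numbered from `0`, from top to
bottom and from left to right. `horizontal i j` separates the faces `(i, j)` and `(i + 1, j)`;
`slanted i j` separates the faces `(i, j)` and `(i, j + 1)`. -/
inductive MiuraCrease (m n : ℕ) : Type
  | horizontal (i : Fin (m - 1)) (j : Fin n) : MiuraCrease m n
  | slanted (i : Fin m) (j : Fin (n - 1)) : MiuraCrease m n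

/-- The corners of the parallelograms of a Miura-ori whose parallelograms have horizontal sides
of length `a`, slanted sides of length `b` and acute angle `θ`, in the plane `ℂ`. The point in
row `r` and column `c` is the upper left corner of the face `(r, c)`; the horizontal lines are
crossed by zig-zags, and the upper left corner of the whole pattern is obtuse. -/
def miuraPoint (a b θ : ℝ) (r c : ℕ) : ℂ :=
  ⟨c * a + (if Even r then b * Real.cos θ else 0), -(r * (b * Real.sin θ))⟩

/-- The Miura-ori `M_{m,n}`. Its interior vertex `(i, j)` is the common corner of the faces
`(i, j)`, `(i, j + 1)`, `(i + 1, j)`, `(i + 1, j + 1)`; the creases there are listed in the order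
right, up, left, down. -/
def miura (m n : ℕ) (a b θ : ℝ) : CreasePattern where
  Vertex := Fin (m - 1) × Fin (n - 1)
  Crease := MiuraCrease m n
  Face := Fin m × Fin n
  deg := fun _ => 4
  deg_neZero := fun _ => inferInstance
  creaseAt := fun x =>
    ![.horizontal x.1 ⟨x.2 + 1, by omega⟩, .slanted ⟨x.1, by omega⟩ x.2,
      .horizontal x.1 ⟨x.2, by omega⟩, .slanted ⟨x.1 + 1, by omega⟩ x.2]
  sectorAt := fun x k =>
    let tip : Fin 4 → ℂ :=
      ![miuraPoint a b θ (x.1 + 1) (x.2 + 2), miuraPoint a b θ x.1 (x.2 + 1),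
        miuraPoint a b θ (x.1 + 1) x.2, miuraPoint a b θ (x.1 + 2) (x.2 + 1)]
    EuclideanGeometry.angle (tip k) (miuraPoint a b θ (x.1 + 1) (x.2 + 1)) (tip (k + 1))
  Borders := fun e α =>
    match e with
    | .horizontal i j => (α.1.val = i.val ∨ α.1.val = i.val + 1) ∧ α.2.val = j.val
    | .slanted i j => α.1.val = i.val ∧ (α.2.val = j.val ∨ α.2.val = j.val + 1)

end

/-!
Locally valid MV assignments of `M_{2,n}` are encoded by integer height functions on the faces.

At an interior vertex the sector angles are `θ, π - θ, π - θ, θ`, and a case analysis of the layer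
orders shows that the vertex folds flat exactly when the value of the left crease is the sum of the
values of the other three (`isFlatFolding_miura_iff`). Up to a sign that depends only on the crease,
this says that the steps along the cycle of four faces add up to zero, so they are the gradient of a
function `h` on the faces that changes by `±1` across every crease (`IsHeight`,
`miura_locallyValid_iff`), unique up to an additive constant. Negating the assignment negates `h`. A
face is flippable exactly when it is a local extremum of `h`, and flipping it reflects `h` there,
moving its value by `2` (`IsHeight.flip`, `IsHeight.exists_isExtremum`).

Hence the distance in the flip graph is an `ℓ¹`-distance of heights. A walk of length `ℓ` moves the
height by at most `2 ℓ` in total (`exists_isHeight_of_walk`). Conversely, let `h` and `k` agree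
modulo `2`, with `h < k` somewhere: a face with `h < k` at which `h` is smallest is a local minimum
of `h`, and raising `h` there by `2` brings it closer to `k` (`exists_walk_of_isHeight`).

Each of the two extreme columns contains a local extremum of `h`
(`IsHeight.exists_eq_vertical_of_horizontal`). In degree `2` there is therefore no other one, and
this forces `h` to be, up to sign and a constant, `j` on one row and `j + 1` on the other, where `j`
is the column (`IsHeight.eq_of_isExtremum_left`). The heights of the opposite assignment are `d - h`,
so the distance is half the minimum over `d` of `∑ |2 h - d|`, a sum which is minimal at the median
of `2 h` (`le_sum_range_abs`, `sum_range_abs_eq`).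
-/

/-! ### Flat foldability of a vertex of the Miura-ori -/

/-- A vertex of the Miura-ori, with creases listed in the order right, up, left, down, folds flat
exactly when one of the right, up and down creases differs from the other three creases. For values
`±1` this is the linear condition stated here. -/
theorem isFlatFolding_miura_iff {θ : ℝ} (h0 : 0 < θ) (h1 : θ < Real.pi / 2) (μ : Fin 4 → ℤˣ) :
    (∃ ε p L, IsFlatFolding ![θ, Real.pi - θ, Real.pi - θ, θ] μ ε p L) ↔
      (μ 2 : ℤ) = μ 0 + μ 1 + μ 3 := by
  constructor
  · rintro ⟨ε, p, L, h⟩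
    -- The circle folds so that the creases up and down coincide, and the right crease lies
    -- strictly inside the two wide sectors.
    have t0 : ε 1 = -ε 0 := h.turn 0
    have t1 : ε 2 = -ε 1 := h.turn 1
    have t2 : ε 3 = -ε 2 := h.turn 2
    have i0 : p 1 = p 0 + ((ε 0 : ℤ) : ℝ) * θ := h.isometric 0
    have i1 : p 2 = p 1 + ((ε 1 : ℤ) : ℝ) * (Real.pi - θ) := h.isometric 1
    have i2 : p 3 = p 2 + ((ε 2 : ℤ) : ℝ) * (Real.pi - θ) := h.isometric 2
    have c1 : L 1 ∉ Set.uIoo (L 3) (L 0) := by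
      refine h.not_pierced 0 1 ?_
      change p 0 ∈ Set.uIoo (p 1) (p 2)
      rcases Int.units_eq_one_or (ε 0) with he | he <;>
      · simp only [t0, he, Units.val_neg, Units.val_one, neg_neg, Int.cast_neg, Int.cast_one] at i0 i1
        first
          | rw [Set.uIoo_of_lt (by linarith)]; constructor <;> linarith
          | rw [Set.uIoo_of_gt (by linarith)]; constructor <;> linarith
    have c2 : L 2 ∉ Set.uIoo (L 3) (L 0) := by
      refine h.not_pierced 0 2 ?_
      change p 0 ∈ Set.uIoo (p 2) (p 3)
      rcases Int.units_eq_one_or (ε 0) with he | he <;>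
      · simp only [t1, t0, he, Units.val_neg, Units.val_one, neg_neg, Int.cast_neg,
          Int.cast_one] at i0 i1 i2
        first
          | rw [Set.uIoo_of_lt (by linarith)]; constructor <;> linarith
          | rw [Set.uIoo_of_gt (by linarith)]; constructor <;> linarith
    have hp : p 1 = p 3 := by
      rw [i2, i1, t1]; push_cast; ring
    have hε : ε 1 = ε 3 := by rw [t2, t1, neg_neg]
    have c3 : L 0 ∈ Set.uIoo (L 2) (L 3) ↔ L 1 ∈ Set.uIoo (L 2) (L 3) :=
      h.not_crossed 3 1 (by decide) hp.symm hε.symm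
    have c4 : L 2 ∈ Set.uIoo (L 0) (L 1) ↔ L 3 ∈ Set.uIoo (L 0) (L 1) :=
      h.not_crossed 1 3 (by decide) hp hε
    have q0 : 0 < (μ 0 : ℤ) * (ε 0 : ℤ) * (L 0 - L 3) := h.parity 0
    have q1 : 0 < (μ 1 : ℤ) * (ε 1 : ℤ) * (L 1 - L 0) := h.parity 1
    have q2 : 0 < (μ 2 : ℤ) * (ε 2 : ℤ) * (L 2 - L 1) := h.parity 2
    have q3 : 0 < (μ 3 : ℤ) * (ε 3 : ℤ) * (L 3 - L 2) := h.parity 3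
    rw [← hε] at q3
    rw [t1] at q2
    rw [t0] at q1 q2 q3
    have d1 : L 0 ≠ L 2 := fun e => absurd (h.layer_injective e) (by decide)
    have d2 : L 1 ≠ L 3 := fun e => absurd (h.layer_injective e) (by decide)
    -- What remains is a statement about the order of the four layers.
    simp only [Set.uIoo, Set.mem_Ioo, inf_lt_iff, lt_sup_iff] at c1 c2 c3 c4
    rcases Int.units_eq_one_or (ε 0) with he | he <;>
    rcases Int.units_eq_one_or (μ 0) with m0 | m0 <;>
    rcases Int.units_eq_one_or (μ 1) with m1 | m1 <;>
    rcases Int.units_eq_one_or (μ 2) with m2 | m2 <;>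
    rcases Int.units_eq_one_or (μ 3) with m3 | m3 <;>
    · simp only [he, m0, m1, m2, m3, Units.val_neg, Units.val_one, neg_neg] at q0 q1 q2 q3 ⊢
      omega
  · intro hμ
    -- The positions of the creases are forced; only the layer order has to be chosen.
    have key : ∀ L : Fin 4 → ℤ, Function.Injective L →
        0 < (μ 0 : ℤ) * (L 0 - L 3) → 0 < (μ 1 : ℤ) * (L 0 - L 1) →
        0 < (μ 2 : ℤ) * (L 2 - L 1) → 0 < (μ 3 : ℤ) * (L 2 - L 3) →
        L 1 ∉ Set.uIoo (L 3) (L 0) → L 2 ∉ Set.uIoo (L 3) (L 0) →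
        (L 0 ∈ Set.uIoo (L 2) (L 3) ↔ L 1 ∈ Set.uIoo (L 2) (L 3)) →
        (L 2 ∈ Set.uIoo (L 0) (L 1) ↔ L 3 ∈ Set.uIoo (L 0) (L 1)) →
        ∃ ε p L, IsFlatFolding ![θ, Real.pi - θ, Real.pi - θ, θ] μ ε p L := by
      intro L hL q0 q1 q2 q3 c1 c2 c3 c4
      have u0 : Set.uIoo (-θ) 0 = Set.Ioo (-θ) 0 := Set.uIoo_of_lt (by linarith)
      have u1 : Set.uIoo 0 (θ - Real.pi) = Set.Ioo (θ - Real.pi) 0 := Set.uIoo_of_gt (by linarith)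
      have u2 : Set.uIoo (θ - Real.pi) 0 = Set.Ioo (θ - Real.pi) 0 := Set.uIoo_of_lt (by linarith)
      have u3 : Set.uIoo 0 (-θ) = Set.Ioo (-θ) 0 := Set.uIoo_of_gt (by linarith)
      refine ⟨![1, -1, 1, -1], ![-θ, 0, θ - Real.pi, 0], L, ?_, ?_, hL, ?_, ?_, ?_⟩
      · decide
      · intro i
        fin_cases i
        · change (0 : ℝ) = -θ + ((1 : ℤ) : ℝ) * θ; simp
        · change θ - Real.pi = 0 + ((-1 : ℤ) : ℝ) * (Real.pi - θ); simp
        · change (0 : ℝ) = θ - Real.pi + ((1 : ℤ) : ℝ) * (Real.pi - θ); simp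
        · change -θ = 0 + ((-1 : ℤ) : ℝ) * θ; simp
      · intro i
        fin_cases i
        · change 0 < (μ 0 : ℤ) * 1 * (L 0 - L 3); linarith
        · change 0 < (μ 1 : ℤ) * -1 * (L 1 - L 0); linarith
        · change 0 < (μ 2 : ℤ) * 1 * (L 2 - L 1); linarith
        · change 0 < (μ 3 : ℤ) * -1 * (L 3 - L 2); linarith
      · intro i j h
        have hj : (![-θ, 0, θ - Real.pi, 0] : Fin 4 → ℝ) i ∈ Set.Ioo (-θ) 0 ∨
            ((![-θ, 0, θ - Real.pi, 0] : Fin 4 → ℝ) i ∈ Set.Ioo (θ - Real.pi) 0 ∧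
              (j = 1 ∨ j = 2)) := by
          fin_cases j
          · left; rw [← u0]; exact h
          · right; rw [← u1]; exact ⟨h, Or.inl rfl⟩
          · right; rw [← u2]; exact ⟨h, Or.inr rfl⟩
          · left; rw [← u3]; exact h
        have hi : i = 0 ∧ (j = 1 ∨ j = 2) := by
          fin_cases i <;> simp at hj ⊢ <;>
            first | exact hj.2 | linarith [hj.1.1] | linarith [hj.2]
        obtain ⟨rfl, rfl | rfl⟩ := hi
        · exact c1
        · exact c2
      · intro i j hij hp hε
        have hi : (i = 1 ∧ j = 3) ∨ (i = 3 ∧ j = 1) := by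
          fin_cases i <;> fin_cases j <;> simp at hij hp hε ⊢ <;> linarith
        obtain ⟨rfl, rfl⟩ | ⟨rfl, rfl⟩ := hi
        · exact c4
        · exact c3
    rcases Int.units_eq_one_or (μ 0) with m0 | m0 <;>
    rcases Int.units_eq_one_or (μ 1) with m1 | m1 <;>
    rcases Int.units_eq_one_or (μ 2) with m2 | m2 <;>
    rcases Int.units_eq_one_or (μ 3) with m3 | m3 <;>
    simp only [m0, m1, m2, m3, Units.val_neg, Units.val_one, Set.uIoo, Set.mem_Ioo, inf_lt_iff,
      lt_sup_iff] at hμ key <;>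
    first
      | omega
      | exact key ![1, 0, 3, 2] (by decide) (by decide) (by decide) (by decide) (by decide)
          (by decide) (by decide) (by decide) (by decide)
      | exact key ![1, 2, 3, 0] (by decide) (by decide) (by decide) (by decide) (by decide)
          (by decide) (by decide) (by decide) (by decide)
      | exact key ![3, 0, 1, 2] (by decide) (by decide) (by decide) (by decide) (by decide)
          (by decide) (by decide) (by decide) (by decide)
      | exact key ![2, 3, 0, 1] (by decide) (by decide) (by decide) (by decide) (by decide)
          (by decide) (by decide) (by decide) (by decide)
      | exact key ![2, 1, 0, 3] (by decide) (by decide) (by decide) (by decide) (by decide)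
          (by decide) (by decide) (by decide) (by decide)
      | exact key ![0, 3, 2, 1] (by decide) (by decide) (by decide) (by decide) (by decide)
          (by decide) (by decide) (by decide) (by decide)

theorem Complex.angle_eq_of_re_mul_re_add_im_mul_im {x y : ℂ} {φ r s : ℝ} (hr : 0 < r)
    (hs : 0 < s) (hx : x.re ^ 2 + x.im ^ 2 = r ^ 2) (hy : y.re ^ 2 + y.im ^ 2 = s ^ 2)
    (h : x.re * y.re + x.im * y.im = r * s * Real.cos φ) (h0 : 0 ≤ φ) (h1 : φ ≤ Real.pi) :
    InnerProductGeometry.angle x y = φ := by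
  have nx : ‖x‖ = r := by
    rw [Complex.norm_def, Complex.normSq_apply, ← sq, ← sq, hx, Real.sqrt_sq hr.le]
  have ny : ‖y‖ = s := by
    rw [Complex.norm_def, Complex.normSq_apply, ← sq, ← sq, hy, Real.sqrt_sq hs.le]
  have hi : inner ℝ x y = r * s * Real.cos φ := by
    rw [← h, Complex.inner]
    simp only [Complex.mul_re, Complex.conj_re, Complex.conj_im]
    ring
  rw [InnerProductGeometry.angle, hi, nx, ny, mul_div_cancel_left₀ _ (by positivity),
    Real.arccos_cos h0 h1]

theorem miura_sectorAt {n : ℕ} {a b θ : ℝ} (ha : 0 < a) (hb : 0 < b) (h0 : 0 < θ)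
    (h1 : θ < Real.pi / 2) (x : Fin (2 - 1) × Fin (n - 1)) :
    (miura 2 n a b θ).sectorAt x = ![θ, Real.pi - θ, Real.pi - θ, θ] := by
  obtain ⟨⟨i, hi⟩, ⟨j, hj⟩⟩ := x
  obtain rfl : i = 0 := by omega
  have hsc : (b * Real.cos θ) ^ 2 + (b * Real.sin θ) ^ 2 = b ^ 2 := by
    linear_combination b ^ 2 * Real.sin_sq_add_cos_sq θ
  -- The four edge vectors at the vertex: right, up, left and down.
  have right : miuraPoint a b θ (0 + 1) (j + 2) - miuraPoint a b θ (0 + 1) (j + 1) = ⟨a, 0⟩ := by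
    apply Complex.ext <;> simp [miuraPoint]; ring
  have up : miuraPoint a b θ 0 (j + 1) - miuraPoint a b θ (0 + 1) (j + 1) =
      ⟨b * Real.cos θ, b * Real.sin θ⟩ := by
    apply Complex.ext <;> simp [miuraPoint]
  have left : miuraPoint a b θ (0 + 1) j - miuraPoint a b θ (0 + 1) (j + 1) = ⟨-a, 0⟩ := by
    apply Complex.ext <;> simp [miuraPoint]; ring
  have down : miuraPoint a b θ (0 + 2) (j + 1) - miuraPoint a b θ (0 + 1) (j + 1) =
      ⟨b * Real.cos θ, -(b * Real.sin θ)⟩ := by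
    apply Complex.ext <;> simp [miuraPoint]; ring
  funext k
  fin_cases k
  · change InnerProductGeometry.angle
      (miuraPoint a b θ (0 + 1) (j + 2) - miuraPoint a b θ (0 + 1) (j + 1))
      (miuraPoint a b θ 0 (j + 1) - miuraPoint a b θ (0 + 1) (j + 1)) = θ
    rw [right, up]
    apply Complex.angle_eq_of_re_mul_re_add_im_mul_im ha hb <;> try dsimp only
    all_goals linarith
  · change InnerProductGeometry.angle
      (miuraPoint a b θ 0 (j + 1) - miuraPoint a b θ (0 + 1) (j + 1))
      (miuraPoint a b θ (0 + 1) j - miuraPoint a b θ (0 + 1) (j + 1)) = Real.pi - θ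
    rw [up, left]
    apply Complex.angle_eq_of_re_mul_re_add_im_mul_im hb ha <;> try dsimp only
    all_goals first | linarith | (rw [Real.cos_pi_sub]; ring)
  · change InnerProductGeometry.angle
      (miuraPoint a b θ (0 + 1) j - miuraPoint a b θ (0 + 1) (j + 1))
      (miuraPoint a b θ (0 + 2) (j + 1) - miuraPoint a b θ (0 + 1) (j + 1)) = Real.pi - θ
    rw [left, down]
    apply Complex.angle_eq_of_re_mul_re_add_im_mul_im ha hb <;> try dsimp only
    all_goals first | linarith | (rw [Real.cos_pi_sub]; ring)
  · change InnerProductGeometry.angle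
      (miuraPoint a b θ (0 + 2) (j + 1) - miuraPoint a b θ (0 + 1) (j + 1))
      (miuraPoint a b θ (0 + 1) (j + 2) - miuraPoint a b θ (0 + 1) (j + 1)) = θ
    rw [down, right]
    apply Complex.angle_eq_of_re_mul_re_add_im_mul_im hb ha <;> try dsimp only
    all_goals linarith

/-! ### Creases, their two faces, and height functions -/

namespace MiuraCrease

variable {n : ℕ}

/-- The crease in column `j` of the middle line. -/
def spine (j : Fin n) : MiuraCrease 2 n := .horizontal ⟨0, by omega⟩ j

theorem eq_spine_or_eq_slanted (e : MiuraCrease 2 n) :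
    (∃ j, e = spine j) ∨ ∃ i j, ∃ hj : j + 1 < n, e = .slanted i ⟨j, by omega⟩ := by
  obtain ⟨⟨i, hi⟩, j⟩ | ⟨i, j, hj⟩ := e
  · obtain rfl : i = 0 := by omega
    exact Or.inl ⟨j, rfl⟩
  · exact Or.inr ⟨i, j, by omega, rfl⟩

/-- The upper face at a horizontal crease, the left face at a slanted crease. -/
def fstFace : MiuraCrease 2 n → Fin 2 × Fin n
  | .horizontal i j => (⟨i, by omega⟩, j)
  | .slanted i j => (i, ⟨j, by omega⟩)

/-- The lower face at a horizontal crease, the right face at a slanted crease. -/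
def sndFace : MiuraCrease 2 n → Fin 2 × Fin n
  | .horizontal i j => (⟨i + 1, by omega⟩, j)
  | .slanted i j => (i, ⟨j + 1, by omega⟩)

/-- The sign relating the value of a crease to the change of height across it. With `-1` on the
slanted creases of the lower row only, the vertex condition says that the signed values, as steps
from the first face of a crease to the second, add up to zero along the cycle of the four faces at
the vertex. -/
def sign : MiuraCrease 2 n → ℤˣ
  | .horizontal _ _ => 1
  | .slanted i _ => if i = 0 then 1 else -1

section simpLemmas

variable (i : Fin 2) (j : Fin n) (k : Fin (n - 1))

@[simp] theorem fstFace_spine : (spine j).fstFace = (0, j) := rfl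

@[simp] theorem sndFace_spine : (spine j).sndFace = (1, j) := rfl

@[simp] theorem sign_spine : (spine j).sign = 1 := rfl

@[simp] theorem fstFace_slanted :
    (slanted i k : MiuraCrease 2 n).fstFace = (i, ⟨k, by omega⟩) := rfl

@[simp] theorem sndFace_slanted :
    (slanted i k : MiuraCrease 2 n).sndFace = (i, ⟨k + 1, by omega⟩) := rfl

@[simp] theorem sign_slanted :
    (slanted i k : MiuraCrease 2 n).sign = if i = 0 then 1 else -1 := rfl

end simpLemmas

theorem fstFace_ne_sndFace (e : MiuraCrease 2 n) : e.fstFace ≠ e.sndFace := by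
  obtain ⟨j, rfl⟩ | ⟨i, j, hj, rfl⟩ := e.eq_spine_or_eq_slanted <;> simp

end MiuraCrease

section Height

open MiuraCrease

variable {n : ℕ} {a b θ : ℝ} {μ ν : MiuraCrease 2 n → ℤˣ} {h k : Fin 2 × Fin n → ℤ}

theorem miura_borders_iff (e : MiuraCrease 2 n) (f : Fin 2 × Fin n) :
    (miura 2 n a b θ).Borders e f ↔ e.fstFace = f ∨ e.sndFace = f := by
  obtain ⟨i, j⟩ := f
  obtain ⟨⟨l, hl⟩, k⟩ | ⟨l, k⟩ := e
  · change (i.val = l ∨ i.val = l + 1) ∧ j.val = k.val ↔ _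
    simp only [fstFace, sndFace, Prod.mk.injEq, Fin.ext_iff]
    omega
  · change i.val = l.val ∧ (j.val = k.val ∨ j.val = k.val + 1) ↔ _
    simp only [fstFace, sndFace, Prod.mk.injEq, Fin.ext_iff]
    omega

theorem miura_flip_apply (μ : MiuraCrease 2 n → ℤˣ) (f : Fin 2 × Fin n) (e : MiuraCrease 2 n) :
    (miura 2 n a b θ).flip μ f e = if e.fstFace = f ∨ e.sndFace = f then -μ e else μ e := by
  change @ite _ ((miura 2 n a b θ).Borders e f) (Classical.propDecidable _) (-μ e) (μ e) = _
  classical exact if_congr (miura_borders_iff e f) rfl rfl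

/-- `h` is a height function of the MV assignment `μ`: across each crease, from its first face to its
second one, it changes by the value of the crease times the sign of the crease. -/
def IsHeight (μ : MiuraCrease 2 n → ℤˣ) (h : Fin 2 × Fin n → ℤ) : Prop :=
  ∀ e : MiuraCrease 2 n, h e.sndFace - h e.fstFace = ((e.sign * μ e : ℤˣ) : ℤ)

theorem isHeight_iff :
    IsHeight μ h ↔
      (∀ j, h (1, j) - h (0, j) = μ (spine j)) ∧
      (∀ j (hj : j + 1 < n), h (0, ⟨j + 1, hj⟩) - h (0, ⟨j, by omega⟩) =
        μ (.slanted 0 ⟨j, by omega⟩)) ∧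
      (∀ j (hj : j + 1 < n), h (1, ⟨j + 1, hj⟩) - h (1, ⟨j, by omega⟩) =
        -μ (.slanted 1 ⟨j, by omega⟩)) := by
  constructor
  · intro H
    refine ⟨fun j => ?_, fun j hj => ?_, fun j hj => ?_⟩
    · simpa using H (spine j)
    · simpa using H (.slanted 0 ⟨j, by omega⟩)
    · simpa using H (.slanted 1 ⟨j, by omega⟩)
  · rintro ⟨h1, h2, h3⟩ e
    obtain ⟨j, rfl⟩ | ⟨i, j, hj, rfl⟩ := e.eq_spine_or_eq_slanted
    · simpa using h1 j
    · fin_cases i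
      · simpa using h2 j hj
      · simpa using h3 j hj

namespace IsHeight

theorem unit_step (H : IsHeight μ h) (e : MiuraCrease 2 n) :
    h e.sndFace - h e.fstFace = 1 ∨ h e.sndFace - h e.fstFace = -1 := by
  rw [H e]
  rcases Int.units_eq_one_or (e.sign * μ e) with hu | hu <;> simp [hu]

theorem unit_step_vertical (H : IsHeight μ h) (i : Fin 2) (j : Fin n) :
    h (i.rev, j) - h (i, j) = 1 ∨ h (i.rev, j) - h (i, j) = -1 := by
  have := H.unit_step (spine j)
  fin_cases i
  · exact this
  · change h (0, j) - h (1, j) = 1 ∨ h (0, j) - h (1, j) = -1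
    change h (1, j) - h (0, j) = 1 ∨ h (1, j) - h (0, j) = -1 at this
    omega

theorem unit_step_horizontal (H : IsHeight μ h) (i : Fin 2) (j : ℕ) (hj : j + 1 < n) :
    h (i, ⟨j + 1, hj⟩) - h (i, ⟨j, by omega⟩) = 1 ∨
      h (i, ⟨j + 1, hj⟩) - h (i, ⟨j, by omega⟩) = -1 :=
  H.unit_step (.slanted i ⟨j, by omega⟩)

theorem eq_of_isHeight (H : IsHeight μ h) (K : IsHeight ν h) : μ = ν := by
  funext e
  have := (H e).symm.trans (K e)
  exact mul_left_cancel (Units.ext this)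

theorem neg_add_const (H : IsHeight μ h) (c : ℤ) : IsHeight (-μ) fun f => -h f + c := by
  intro e
  simp only [Pi.neg_apply, mul_neg, Units.val_neg, ← H e]
  ring

theorem exists_eq_add_const (hn : 0 < n) (H : IsHeight μ h) (K : IsHeight μ k) :
    ∃ c, ∀ f, k f = h f + c := by
  rw [isHeight_iff] at H K
  obtain ⟨h1, h2, -⟩ := H
  obtain ⟨k1, k2, -⟩ := K
  refine ⟨k (0, ⟨0, hn⟩) - h (0, ⟨0, hn⟩), ?_⟩
  have top : ∀ j (hj : j < n), k (0, ⟨j, hj⟩) = h (0, ⟨j, hj⟩) +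
      (k (0, ⟨0, hn⟩) - h (0, ⟨0, hn⟩)) := by
    intro j
    induction j with
    | zero => intro hj; ring
    | succ j ih =>
      intro hj
      have := ih (by omega)
      have := h2 j hj
      have := k2 j hj
      omega
  rintro ⟨i, j, hj⟩
  have := top j hj
  have := h1 ⟨j, hj⟩
  have := k1 ⟨j, hj⟩
  fin_cases i
  · change k (0, _) = h (0, _) + _
    omega
  · change k (1, _) = h (1, _) + _
    omega

end IsHeight

/-- The vertex conditions are the integrability condition for a height function. -/
theorem exists_isHeight_iff :
    (∃ h, IsHeight μ h) ↔ ∀ j (hj : j + 1 < n),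
      (μ (spine ⟨j, by omega⟩) : ℤ) =
        μ (spine ⟨j + 1, hj⟩) + μ (.slanted 0 ⟨j, by omega⟩) +
          μ (.slanted 1 ⟨j, by omega⟩) := by
  constructor
  · rintro ⟨h, H⟩ j hj
    obtain ⟨h1, h2, h3⟩ := isHeight_iff.1 H
    have := h1 ⟨j, by omega⟩
    have := h1 ⟨j + 1, hj⟩
    have := h2 j hj
    have := h3 j hj
    omega
  · intro H
    -- The top row is the sequence of partial sums, the bottom row differs from it by
    -- the values of `μ` on the middle line.
    let T : ℕ → ℤ := fun j => ∑ i ∈ Finset.range j,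
      if hi : i < n - 1 then (μ (.slanted 0 ⟨i, hi⟩) : ℤ) else 0
    have hT : ∀ j (hj : j + 1 < n), T (j + 1) = T j + μ (.slanted 0 ⟨j, by omega⟩) := by
      intro j hj
      simp only [T, Finset.sum_range_succ]
      rw [dif_pos (by omega)]
    refine ⟨fun f => T f.2 + if f.1 = 0 then 0 else (μ (spine f.2) : ℤ), ?_⟩
    rw [isHeight_iff]
    refine ⟨fun j => ?_, fun j hj => ?_, fun j hj => ?_⟩
    · simp
    · simp [hT j hj]
    · have := H j hj
      simp [hT j hj]
      omega

theorem miura_locallyValid_iff (ha : 0 < a) (hb : 0 < b) (h0 : 0 < θ) (h1 : θ < Real.pi / 2) :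
    (miura 2 n a b θ).LocallyValid μ ↔ ∃ h, IsHeight μ h := by
  rw [exists_isHeight_iff]
  have vertex : ∀ j (hj : j < n - 1),
      (∃ (ε : Fin 4 → ℤˣ) (p : Fin 4 → ℝ) (L : Fin 4 → ℤ),
        IsFlatFolding (d := 4) ((miura 2 n a b θ).sectorAt (⟨0, by omega⟩, ⟨j, hj⟩))
        (fun i => μ ((miura 2 n a b θ).creaseAt (⟨0, by omega⟩, ⟨j, hj⟩) i)) ε p L) ↔
      (μ (spine ⟨j, by omega⟩) : ℤ) = μ (spine ⟨j + 1, by omega⟩) + μ (.slanted 0 ⟨j, hj⟩) +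
        μ (.slanted 1 ⟨j, hj⟩) := by
    intro j hj
    rw [miura_sectorAt ha hb h0 h1]
    exact isFlatFolding_miura_iff h0 h1 _
  constructor
  · intro H j hj
    exact (vertex j (by omega)).1 (H (⟨0, by omega⟩, ⟨j, by omega⟩))
  · rintro H ⟨⟨i, hi⟩, j, hj⟩
    obtain rfl : i = 0 := by omega
    exact (vertex j hj).2 (H j (by omega))

/-- All neighbours of the face `f` have height `h f + s`: `f` is a local minimum of `h` if `s = 1`
and a local maximum if `s = -1`. -/
def IsExtremum (h : Fin 2 × Fin n → ℤ) (f : Fin 2 × Fin n) (s : ℤˣ) : Prop :=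
  ∀ e : MiuraCrease 2 n, (e.fstFace = f → h e.sndFace = h f + s) ∧
    (e.sndFace = f → h e.fstFace = h f + s)

theorem isExtremum_iff {i : Fin 2} {j : ℕ} {hj : j < n} {s : ℤˣ} :
    IsExtremum h (i, ⟨j, hj⟩) s ↔
      h (i.rev, ⟨j, hj⟩) = h (i, ⟨j, hj⟩) + s ∧
      (∀ hj' : j + 1 < n, h (i, ⟨j + 1, hj'⟩) = h (i, ⟨j, hj⟩) + s) ∧
      (∀ j' (hj' : j' + 1 = j), h (i, ⟨j', by omega⟩) = h (i, ⟨j, hj⟩) + s) := by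
  constructor
  · intro H
    refine ⟨?_, fun hj' => ?_, fun j' hj' => ?_⟩
    · have := H (spine ⟨j, hj⟩)
      fin_cases i
      · exact this.1 rfl
      · exact this.2 rfl
    · exact (H (.slanted i ⟨j, by omega⟩)).1 rfl
    · subst hj'
      exact (H (.slanted i ⟨j', by omega⟩)).2 rfl
  · rintro ⟨h1, h2, h3⟩ e
    obtain ⟨k, rfl⟩ | ⟨l, k, hk, rfl⟩ := e.eq_spine_or_eq_slanted
    · constructor
      · simp only [fstFace_spine, Prod.mk.injEq]
        rintro ⟨rfl, rfl⟩
        exact h1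
      · simp only [sndFace_spine, Prod.mk.injEq]
        rintro ⟨rfl, rfl⟩
        exact h1
    · constructor
      · simp only [fstFace_slanted, Prod.mk.injEq, Fin.mk.injEq]
        rintro ⟨rfl, rfl⟩
        exact h2 _
      · simp only [sndFace_slanted, Prod.mk.injEq, Fin.mk.injEq]
        rintro ⟨rfl, rfl⟩
        exact h3 _ rfl

/-! ### Face flips and local extrema -/

/-- Flipping a local extremum reflects its height in the common height of its neighbours. -/
theorem IsHeight.flip {f : Fin 2 × Fin n} {s : ℤˣ} (H : IsHeight μ h) (hf : IsExtremum h f s) :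
    IsHeight ((miura 2 n a b θ).flip μ f) (Function.update h f (h f + 2 * s)) := by
  intro e
  rw [miura_flip_apply]
  have hne := e.fstFace_ne_sndFace
  have He := H e
  by_cases h1 : e.fstFace = f
  · have h2 : e.sndFace ≠ f := fun h2 => hne (h1.trans h2.symm)
    have := (hf e).1 h1
    rw [h1] at He
    rw [h1, Function.update_self, Function.update_of_ne h2, if_pos (Or.inl rfl), mul_neg,
      Units.val_neg]
    omega
  · by_cases h2 : e.sndFace = f
    · have := (hf e).2 h2
      rw [h2] at He
      rw [h2, Function.update_self, Function.update_of_ne h1, if_pos (Or.inr rfl), mul_neg,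
        Units.val_neg]
      omega
    · rw [Function.update_of_ne h2, Function.update_of_ne h1, if_neg (by tauto), He]

/-- A face whose flip is again locally valid is a local extremum: comparing the vertex condition
before and after the flip relates the values of the two creases of the face at that vertex. -/
theorem IsHeight.exists_isExtremum {f : Fin 2 × Fin n} (H : IsHeight μ h)
    (K : IsHeight ((miura 2 n a b θ).flip μ f) k) : ∃ s, IsExtremum h f s := by
  have E1 := exists_isHeight_iff.1 ⟨h, H⟩
  have E2 := exists_isHeight_iff.1 ⟨k, K⟩
  obtain ⟨h1, h2, h3⟩ := isHeight_iff.1 H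
  obtain ⟨i, j, hj⟩ := f
  fin_cases i
  · refine ⟨μ (spine ⟨j, hj⟩), isExtremum_iff.2 ⟨?_, ?_, ?_⟩⟩
    · exact eq_add_of_sub_eq' (h1 ⟨j, hj⟩)
    · intro hj'
      have e1 := E1 j hj'
      have e2 := E2 j hj'
      simp [miura_flip_apply] at e2
      have := h2 j hj'
      simp only [Fin.zero_eta]
      omega
    · rintro j' rfl
      have e1 := E1 j' hj
      have e2 := E2 j' hj
      simp [miura_flip_apply] at e2
      have := h2 j' hj
      simp only [Fin.zero_eta]
      omega
  · refine ⟨-μ (spine ⟨j, hj⟩), isExtremum_iff.2 ⟨?_, ?_, ?_⟩⟩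
    · have := h1 ⟨j, hj⟩
      change h (0, _) = h (1, _) + _
      rw [Units.val_neg]
      omega
    · intro hj'
      have e1 := E1 j hj'
      have e2 := E2 j hj'
      simp [miura_flip_apply] at e2
      have := h3 j hj'
      simp only [Fin.mk_one, Units.val_neg]
      omega
    · rintro j' rfl
      have e1 := E1 j' hj
      have e2 := E2 j' hj
      simp [miura_flip_apply] at e2
      have := h3 j' hj
      simp only [Fin.mk_one, Units.val_neg]
      omega

/-! ### Extrema in the extreme columns -/

/-- Of the two faces of a column, one has the same height step to the other face of the column as to
its neighbour in a given adjacent column. Around the square formed by the two columns the four steps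
sum to zero, so if the face in row `0` fails, the face in row `1` does not. -/
theorem IsHeight.exists_eq_vertical_of_horizontal (H : IsHeight μ h) (j k : Fin n)
    (hjk : (j : ℕ) + 1 = k ∨ (k : ℕ) + 1 = j) :
    ∃ (i : Fin 2) (s : ℤˣ), h (i.rev, j) = h (i, j) + s ∧ h (i, k) = h (i, j) + s := by
  have step : ∀ i, h (i, k) - h (i, j) = 1 ∨ h (i, k) - h (i, j) = -1 := by
    intro i
    obtain ⟨j, hj⟩ := j
    obtain ⟨k, hk⟩ := k
    simp only at hjk
    rcases hjk with rfl | rfl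
    · exact H.unit_step_horizontal i j hk
    · have := H.unit_step_horizontal i k hj
      omega
  have a0 := step 0
  have a1 := step 1
  have b0 : h (1, j) - h (0, j) = 1 ∨ h (1, j) - h (0, j) = -1 := H.unit_step_vertical 0 j
  have b1 : h (1, k) - h (0, k) = 1 ∨ h (1, k) - h (0, k) = -1 := H.unit_step_vertical 0 k
  by_cases hc : h (0, k) = h (1, j)
  · rcases b0 with b0 | b0
    · refine ⟨0, 1, ?_, ?_⟩
      · change h (1, j) = h (0, j) + 1
        omega
      · rw [Units.val_one]
        omega
    · refine ⟨0, -1, ?_, ?_⟩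
      · change h (1, j) = h (0, j) + -1
        omega
      · rw [Units.val_neg, Units.val_one]
        omega
  · rcases b0 with b0 | b0
    · refine ⟨1, -1, ?_, ?_⟩
      · change h (0, j) = h (1, j) + -1
        omega
      · rw [Units.val_neg, Units.val_one]
        omega
    · refine ⟨1, 1, ?_, ?_⟩
      · change h (0, j) = h (1, j) + 1
        omega
      · rw [Units.val_one]
        omega

theorem IsHeight.exists_isExtremum_left (hn : 1 < n) (H : IsHeight μ h) :
    ∃ i s, IsExtremum h (i, ⟨0, by omega⟩) s := by
  obtain ⟨i, s, h1, h2⟩ := H.exists_eq_vertical_of_horizontal ⟨0, by omega⟩ ⟨1, hn⟩ (Or.inl rfl)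
  exact ⟨i, s, isExtremum_iff.2 ⟨h1, fun _ => h2, fun j' hj' => by omega⟩⟩

theorem IsHeight.exists_isExtremum_right (hn : 1 < n) (H : IsHeight μ h) :
    ∃ i s, IsExtremum h (i, ⟨n - 1, by omega⟩) s := by
  obtain ⟨i, s, h1, h2⟩ := H.exists_eq_vertical_of_horizontal ⟨n - 1, by omega⟩ ⟨n - 2, by omega⟩
    (Or.inr (by simp only; omega))
  refine ⟨i, s, isExtremum_iff.2 ⟨h1, fun _ => by omega, fun j' hj' => ?_⟩⟩
  obtain rfl : j' = n - 2 := by omega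
  exact h2

/-- If row `r` has a local extremum in column `0` and the other row has none before the last column,
then the height is monotone along both rows: the first turn of the other row would be a local
extremum, and then row `r` has no choice, its next face having height within `1` both of its
predecessor and of the face in the other row. -/
theorem IsHeight.eq_of_isExtremum_left (hn : 0 < n) (H : IsHeight μ h) {r : Fin 2} {s : ℤˣ}
    (hr : IsExtremum h (r, ⟨0, hn⟩) s)
    (hne : ∀ j (hj : j + 1 < n) t, ¬ IsExtremum h (r.rev, ⟨j, by omega⟩) t) (j : ℕ) (hj : j < n) :
    h (r, ⟨j, hj⟩) = h (r, ⟨0, hn⟩) + s * j ∧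
      h (r.rev, ⟨j, hj⟩) = h (r, ⟨0, hn⟩) + s * (j + 1) := by
  induction j using Nat.strong_induction_on with
  | _ j ih =>
    obtain _ | j := j
    · refine ⟨by simp, ?_⟩
      simpa using (isExtremum_iff.1 hr).1
    · obtain ⟨i1, i2⟩ := ih j (by omega) (by omega)
      have st := H.unit_step_horizontal r j hj
      have st' := H.unit_step_horizontal r.rev j hj
      have sv := H.unit_step_vertical r ⟨j + 1, hj⟩
      have next : h (r.rev, ⟨j + 1, hj⟩) = h (r.rev, ⟨j, by omega⟩) + s := by
        by_contra hc
        refine hne j hj (-s) (isExtremum_iff.2 ⟨?_, fun _ => ?_, ?_⟩)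
        · rw [Fin.rev_rev, i1, i2, Units.val_neg]
          ring
        · rcases Int.units_eq_one_or s with rfl | rfl <;>
          · simp only [Units.val_one, Units.val_neg] at hc ⊢
            omega
        · rintro j' rfl
          rw [(ih j' (by omega) (by omega)).2, i2, Units.val_neg]
          push_cast
          ring
      rcases Int.units_eq_one_or s with rfl | rfl <;>
      · simp only [Units.val_one, Units.val_neg] at i1 i2 next ⊢
        push_cast at i1 i2 next ⊢
        constructor <;> omega

/-! ### Walks in the flip graph -/

theorem miura_flip_ne (μ : MiuraCrease 2 n → ℤˣ) (f : Fin 2 × Fin n) :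
    (miura 2 n a b θ).flip μ f ≠ μ := by
  intro e
  have hc := congrFun e (spine f.2)
  rw [miura_flip_apply, if_pos] at hc
  · exact units_ne_neg_self _ hc.symm
  · obtain ⟨i, j⟩ := f
    fin_cases i
    · exact Or.inl rfl
    · exact Or.inr rfl

/-- Heights that agree modulo `2` and have `ℓ¹`-distance `2 N` are joined by at most `N` flips. -/
theorem exists_walk_of_isHeight (ha : 0 < a) (hb : 0 < b) (h0 : 0 < θ) (h1 : θ < Real.pi / 2)
    (N : ℕ) (μ ν : (miura 2 n a b θ).ValidMV) (h k : Fin 2 × Fin n → ℤ) (H : IsHeight μ.1 h)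
    (K : IsHeight ν.1 k) (hk : ∀ f, Even (k f - h f)) (hN : ∑ f, |k f - h f| = 2 * N) :
    ∃ w : (miura 2 n a b θ).OFG.Walk μ ν, w.length ≤ N := by
  induction N generalizing μ ν h k with
  | zero =>
    have : h = k := by
      funext f
      have := (Finset.sum_eq_zero_iff_of_nonneg fun f _ => abs_nonneg (k f - h f)).1
        (by simpa using hN) f (Finset.mem_univ f)
      rw [abs_eq_zero] at this
      omega
    subst this
    obtain rfl : μ = ν := Subtype.ext (H.eq_of_isHeight K)
    exact ⟨.nil, le_rfl⟩
  | succ N ih =>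
    -- By symmetry in `h` and `k` it is enough to treat the case that `h` lies below `k` somewhere.
    have up : ∀ (μ ν : (miura 2 n a b θ).ValidMV) (h k : Fin 2 × Fin n → ℤ), IsHeight μ.1 h →
        IsHeight ν.1 k → (∀ f, Even (k f - h f)) → ∑ f, |k f - h f| = 2 * (N + 1 : ℕ) →
        (∃ f, h f < k f) → ∃ w : (miura 2 n a b θ).OFG.Walk μ ν, w.length ≤ N + 1 := by
      intro μ ν h k H K hk hN hlt
      obtain ⟨f, hf, hmin⟩ := Set.exists_min_image {f | h f < k f} h (Set.toFinite _) hlt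
      have hf2 : h f + 2 ≤ k f := by
        obtain ⟨c, hc⟩ := hk f
        have : h f < k f := hf
        omega
      -- A lower neighbour `g` of `f` would have `k g ≥ k f - 1 > h g`, against minimality.
      have hf1 : IsExtremum h f 1 := by
        intro e
        have s1 := H.unit_step e
        have s2 := K.unit_step e
        simp only [Set.mem_ofPred_eq] at hmin
        rw [Units.val_one]
        constructor
        · rintro rfl
          have := hmin e.sndFace
          omega
        · rintro rfl
          have := hmin e.fstFace
          omega
      have H' := H.flip (a := a) (b := b) (θ := θ) hf1
      rw [Units.val_one, mul_one] at H'
      let μ' : (miura 2 n a b θ).ValidMV :=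
        ⟨(miura 2 n a b θ).flip μ.1 f, (miura_locallyValid_iff ha hb h0 h1).2 ⟨_, H'⟩⟩
      have hsum : ∑ g, |k g - Function.update h f (h f + 2) g| = 2 * N := by
        have e1 := Finset.add_sum_erase Finset.univ (fun g => |k g - h g|) (Finset.mem_univ f)
        have e2 := Finset.add_sum_erase Finset.univ
          (fun g => |k g - Function.update h f (h f + 2) g|) (Finset.mem_univ f)
        have e3 : ∑ g ∈ Finset.univ.erase f, |k g - Function.update h f (h f + 2) g| =
            ∑ g ∈ Finset.univ.erase f, |k g - h g| :=
          Finset.sum_congr rfl fun g hg => by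
            rw [Function.update_of_ne (Finset.ne_of_mem_erase hg)]
        simp only [Function.update_self] at e1 e2
        rw [abs_of_nonneg (by omega)] at e1 e2
        push_cast at hN
        omega
      obtain ⟨w, hw⟩ := ih μ' ν _ k H' K (fun g => by
        by_cases hg : g = f
        · subst hg
          rw [Function.update_self, ← sub_sub]
          exact (hk g).sub even_two
        · rw [Function.update_of_ne hg]
          exact hk g) hsum
      have adj : (miura 2 n a b θ).OFG.Adj μ μ' :=
        ⟨fun e => miura_flip_ne μ.1 f (congrArg Subtype.val e).symm, f, rfl⟩
      exact ⟨.cons adj w, by simpa using hw⟩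
    by_cases hlt : ∃ f, h f < k f
    · exact up μ ν h k H K hk hN hlt
    · push Not at hlt
      have : ∃ f, k f < h f := by
        by_contra! hc
        have : ∀ f, k f - h f = 0 := fun f => by have := hlt f; have := hc f; omega
        simp [this] at hN
        omega
      obtain ⟨w, hw⟩ := up ν μ k h K H (fun f => by rw [← neg_sub]; exact (hk f).neg)
        (by simp only [abs_sub_comm (h _)]; exact hN) this
      exact ⟨w.reverse, by simpa using hw⟩

/-- A flip moves the height by `2` at a single face, so heights can be transported along a walk at
`ℓ¹`-cost at most twice its length. -/
theorem exists_isHeight_of_walk {μ ν : (miura 2 n a b θ).ValidMV} (ha : 0 < a) (hb : 0 < b)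
    (h0 : 0 < θ) (h1 : θ < Real.pi / 2)
    (w : (miura 2 n a b θ).OFG.Walk μ ν) {h : Fin 2 × Fin n → ℤ} (H : IsHeight μ.1 h) :
    ∃ k, IsHeight ν.1 k ∧ ∑ f, |k f - h f| ≤ 2 * w.length := by
  induction w generalizing h with
  | nil => exact ⟨h, H, by simp⟩
  | @cons μ μ' ν adj w ih =>
    obtain ⟨-, (f : Fin 2 × Fin n), hf⟩ := id adj
    obtain ⟨k, K⟩ := (miura_locallyValid_iff ha hb h0 h1).1 μ'.2
    rw [hf] at K
    obtain ⟨s, hs⟩ := H.exists_isExtremum K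
    have H' := H.flip (a := a) (b := b) (θ := θ) hs
    rw [← hf] at H'
    obtain ⟨k, K, hk⟩ := ih H'
    refine ⟨k, K, ?_⟩
    have e1 : ∑ g, |Function.update h f (h f + 2 * s) g - h g| = 2 := by
      rw [Finset.sum_eq_single f]
      · rw [Function.update_self, add_sub_cancel_left]
        rcases Int.units_eq_one_or s with rfl | rfl <;> simp
      · intro g _ hg
        simp [hg]
      · simp
    calc ∑ g, |k g - h g| ≤ ∑ g, (|k g - Function.update h f (h f + 2 * s) g| +
          |Function.update h f (h f + 2 * s) g - h g|) :=
        Finset.sum_le_sum fun g _ => abs_sub_le _ _ _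
      _ ≤ _ := by
        rw [Finset.sum_add_distrib, e1, SimpleGraph.Walk.length_cons]
        push_cast
        linarith

/-! ### Vertices of degree two -/

theorem miura_flip_injective (hn : 1 < n) (μ : MiuraCrease 2 n → ℤˣ) :
    Function.Injective ((miura 2 n a b θ).flip μ) := by
  intro (f : Fin 2 × Fin n) (g : Fin 2 × Fin n) hfg
  have key : ∀ e : MiuraCrease 2 n, (e.fstFace = f ∨ e.sndFace = f) →
      (e.fstFace = g ∨ e.sndFace = g) := by
    intro e he
    by_contra hg
    have := congrFun hfg e
    rw [miura_flip_apply, miura_flip_apply, if_pos he, if_neg hg] at this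
    exact units_ne_neg_self _ this.symm
  obtain ⟨i, j, hj⟩ := f
  obtain ⟨i', j', hj'⟩ := g
  have c1 := key (spine ⟨j, hj⟩)
  simp only [fstFace_spine, sndFace_spine, Prod.mk.injEq, Fin.ext_iff] at c1
  have hi := i.2
  have hi' := i'.2
  change ((i, ⟨j, hj⟩) : Fin 2 × Fin n) = (i', ⟨j', hj'⟩)
  rw [Prod.mk.injEq, Fin.ext_iff, Fin.mk.injEq]
  by_cases hj1 : j + 1 < n
  · have c2 := key (.slanted i ⟨j, by omega⟩)
    simp only [fstFace_slanted, sndFace_slanted, Prod.mk.injEq, Fin.ext_iff] at c2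
    simp at c1 c2
    omega
  · have c2 := key (.slanted i ⟨j - 1, by omega⟩)
    simp only [fstFace_slanted, sndFace_slanted, Prod.mk.injEq, Fin.ext_iff] at c2
    simp at c1 c2
    omega

theorem ncard_neighborSet_OFG_miura (hn : 1 < n) (μ : (miura 2 n a b θ).ValidMV) :
    ((miura 2 n a b θ).OFG.neighborSet μ).ncard = ((miura 2 n a b θ).flippableFaces μ).ncard := by
  symm
  refine Set.ncard_congr (fun f hf => ⟨(miura 2 n a b θ).flip μ.1 f, hf⟩) ?_ ?_ ?_
  · intro f hf
    exact ⟨fun e => miura_flip_ne μ.1 f (congrArg Subtype.val e).symm, f, rfl⟩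
  · intro f g hf hg hfg
    exact miura_flip_injective hn μ.1 (congrArg Subtype.val hfg)
  · rintro ν ⟨-, f, hf⟩
    exact ⟨f, by rw [CreasePattern.flippableFaces, Set.mem_ofPred_eq, ← hf]; exact ν.2,
      Subtype.ext hf.symm⟩

/-- The height of a vertex of degree `2` is determined up to sign, constant and exchange of rows. -/
theorem exists_height_eq_of_ncard_neighborSet_eq_two (hn : 1 < n) (ha : 0 < a) (hb : 0 < b)
    (h0 : 0 < θ) (h1 : θ < Real.pi / 2) (μ : (miura 2 n a b θ).ValidMV)
    (hμ : ((miura 2 n a b θ).OFG.neighborSet μ).ncard = 2) :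
    ∃ (h : Fin 2 × Fin n → ℤ) (r : Fin 2) (s : ℤˣ), IsHeight μ.1 h ∧ ∃ c,
      ∀ j : Fin n, h (r, j) = c + s * j ∧ h (r.rev, j) = c + s * (j + 1) := by
  rw [ncard_neighborSet_OFG_miura hn] at hμ
  obtain ⟨h, H⟩ := (miura_locallyValid_iff ha hb h0 h1).1 μ.2
  have flippable : ∀ f s, IsExtremum h f s → f ∈ (miura 2 n a b θ).flippableFaces μ :=
    fun f s hf => (miura_locallyValid_iff ha hb h0 h1).2 ⟨_, H.flip hf⟩
  obtain ⟨i, s, hi⟩ := H.exists_isExtremum_left hn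
  obtain ⟨i', s', hi'⟩ := H.exists_isExtremum_right hn
  obtain ⟨x, y, -, hxy⟩ := Set.ncard_eq_two.1 hμ
  refine ⟨h, i, s, H, h (i, ⟨0, by omega⟩), fun j =>
    H.eq_of_isExtremum_left (by omega) hi (fun j hj t ht => ?_) j j.2⟩
  -- The two extreme columns already account for both flippable faces; a third one is impossible.
  have m1 := flippable _ _ hi
  have m2 := flippable _ _ hi'
  have m3 := flippable _ _ ht
  have n12 : ((i, ⟨0, by omega⟩) : Fin 2 × Fin n) ≠ (i', ⟨n - 1, by omega⟩) := by
    simp only [ne_eq, Prod.mk.injEq, Fin.mk.injEq]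
    omega
  have n13 : ((i, ⟨0, by omega⟩) : Fin 2 × Fin n) ≠ (i.rev, ⟨j, by omega⟩) := by
    fin_cases i <;> simp [Prod.ext_iff, Fin.ext_iff]
  have n23 : ((i', ⟨n - 1, by omega⟩) : Fin 2 × Fin n) ≠ (i.rev, ⟨j, by omega⟩) := by
    simp only [ne_eq, Prod.mk.injEq, Fin.mk.injEq]
    omega
  rw [hxy] at m1 m2 m3
  rcases m1 with m1 | m1 <;> rcases m2 with m2 | m2 <;> rcases m3 with m3 | m3 <;>
    first
      | exact n12 (m1.trans m2.symm)
      | exact n13 (m1.trans m3.symm)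
      | exact n23 (m2.trans m3.symm)

end Height

/-! ### The sum of the deviations from a constant -/

/-- Removing the first and the last column shifts the heights by one, so that two more columns
add four outer terms. -/
theorem sum_range_abs_succ_succ (n : ℕ) (c : ℤ) :
    ∑ j ∈ Finset.range (n + 2), (|2 * (j : ℤ) - (c + 2)| + |2 * ((j : ℤ) + 1) - (c + 2)|) =
      |c + 2| + |c| + ∑ j ∈ Finset.range n, (|2 * (j : ℤ) - c| + |2 * ((j : ℤ) + 1) - c|) +
        (|2 * n - c| + |2 * (n : ℤ) + 2 - c|) := by
  rw [Finset.sum_range_succ', Finset.sum_range_succ]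
  have e1 : ∀ j : ℕ, 2 * ((j + 1 : ℕ) : ℤ) - (c + 2) = 2 * j - c := by intro j; push_cast; ring
  have e2 : ∀ j : ℕ, 2 * (((j + 1 : ℕ) : ℤ) + 1) - (c + 2) = 2 * (j + 1) - c := by
    intro j; push_cast; ring
  have e3 : |2 * ((0 : ℕ) : ℤ) - (c + 2)| = |c + 2| := by rw [← abs_neg]; congr 1; push_cast; ring
  have e4 : |2 * (((0 : ℕ) : ℤ) + 1) - (c + 2)| = |c| := by rw [← abs_neg]; congr 1; push_cast; ring
  simp only [e1, e2, e3, e4]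
  rw [show 2 * ((n : ℤ) + 1) - c = 2 * n + 2 - c by ring]
  ring

/-- The columns are removed in pairs from outside; by the triangle inequality the four outer terms
of `n + 2` columns add up to at least `2 (2 n + 2)`, whatever the constant `c`. -/
theorem le_sum_range_abs (n : ℕ) (c : ℤ) :
    2 * (((n ^ 2 + 1) / 2 : ℕ) : ℤ) ≤
      ∑ j ∈ Finset.range n, (|2 * (j : ℤ) - c| + |2 * ((j : ℤ) + 1) - c|) := by
  induction n using Nat.twoStepInduction generalizing c with
  | zero => simp
  | one =>
    simp
    rcases abs_cases c with h | h <;> rcases abs_cases (2 - c) with h' | h' <;> omega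
  | more n ih _ =>
    have e := sum_range_abs_succ_succ n (c - 2)
    rw [sub_add_cancel] at e
    rw [e]
    have := ih (c - 2)
    have e2 : ((n + 2) ^ 2 + 1) / 2 = (n ^ 2 + 1) / 2 + (2 * n + 2) := by
      rw [show (n + 2) ^ 2 + 1 = n ^ 2 + 1 + (2 * n + 2) * 2 by ring]
      omega
    rw [e2]
    have := neg_abs_le c
    have := le_abs_self c
    have := neg_abs_le (c - 2)
    have := le_abs_self (c - 2)
    have := le_abs_self (2 * n - (c - 2))
    have := le_abs_self (2 * (n : ℤ) + 2 - (c - 2))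
    push_cast at *
    linarith

/-- Equality is attained when `c` lies between every two paired outer terms, as the even median
`2 ⌊n / 2⌋` does. -/
theorem sum_range_abs_eq (n : ℕ) :
    ∑ j ∈ Finset.range n, (|2 * (j : ℤ) - 2 * (n / 2 : ℕ)| +
      |2 * ((j : ℤ) + 1) - 2 * (n / 2 : ℕ)|) = 2 * (((n ^ 2 + 1) / 2 : ℕ) : ℤ) := by
  induction n using Nat.twoStepInduction with
  | zero => simp
  | one => simp
  | more n ih _ =>
    have e := sum_range_abs_succ_succ n (2 * (n / 2 : ℕ))
    rw [ih] at e
    rw [show (n + 2) / 2 = n / 2 + 1 by omega]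
    push_cast at e ⊢
    rw [show 2 * ((n : ℤ) / 2 + 1) = 2 * ((n : ℤ) / 2) + 2 by ring, e]
    have e2 : ((n + 2) ^ 2 + 1) / 2 = (n ^ 2 + 1) / 2 + (2 * n + 2) := by
      rw [show (n + 2) ^ 2 + 1 = n ^ 2 + 1 + (2 * n + 2) * 2 by ring]
      omega
    zify at e2
    rw [e2]
    rw [abs_of_nonneg (by omega), abs_of_nonneg (by omega), abs_of_nonneg (by omega),
      abs_of_nonneg (by omega)]
    omega

theorem Nat.ceil_sq_div_two (n : ℕ) : ⌈(n : ℝ) ^ 2 / 2⌉₊ = (n ^ 2 + 1) / 2 := by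
  have le : (n : ℝ) ^ 2 ≤ 2 * ((n ^ 2 + 1) / 2 : ℕ) := by
    have : n ^ 2 ≤ 2 * ((n ^ 2 + 1) / 2) := by omega
    exact_mod_cast this
  refine le_antisymm (Nat.ceil_le.2 (by linarith)) ?_
  have ge : (n : ℝ) ^ 2 ≤ 2 * ⌈(n : ℝ) ^ 2 / 2⌉₊ := by linarith [Nat.le_ceil ((n : ℝ) ^ 2 / 2)]
  have : n ^ 2 ≤ 2 * ⌈(n : ℝ) ^ 2 / 2⌉₊ := by exact_mod_cast ge
  omega

theorem sum_faces_abs {n : ℕ} {h : Fin 2 × Fin n → ℤ} {r : Fin 2} {s : ℤˣ} {c : ℤ}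
    (hh : ∀ j : Fin n, h (r, j) = c + s * j ∧ h (r.rev, j) = c + s * (j + 1)) (d : ℤ) :
    ∑ f, |2 * h f - d| = ∑ j ∈ Finset.range n, (|2 * (j : ℤ) - s * (d - 2 * c)| +
      |2 * ((j : ℤ) + 1) - s * (d - 2 * c)|) := by
  have hs : (s : ℤ) * s = 1 := by rw [← Units.val_mul, Int.units_mul_self, Units.val_one]
  have key : ∀ x : ℤ, |2 * (c + s * x) - d| = |2 * x - s * (d - 2 * c)| := by
    intro x
    rw [show 2 * (c + s * x) - d = s * (2 * x - s * (d - 2 * c)) by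
      linear_combination (d - 2 * c) * hs, abs_mul]
    rcases Int.units_eq_one_or s with rfl | rfl <;> simp
  have rows : ∑ f, |2 * h f - d| = ∑ j, (|2 * h (r, j) - d| + |2 * h (r.rev, j) - d|) := by
    rw [Fintype.sum_prod_type, Fin.sum_univ_two, Finset.sum_add_distrib]
    fin_cases r
    · rfl
    · exact add_comm _ _
  rw [rows, ← Fin.sum_univ_eq_sum_range
    (fun j => |2 * (j : ℤ) - s * (d - 2 * c)| + |2 * ((j : ℤ) + 1) - s * (d - 2 * c)|)]
  refine Finset.sum_congr rfl fun j _ => ?_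
  rw [(hh j).1, (hh j).2, key, key]

/-! ### The distance between opposite vertices of degree two -/

theorem mainTheorem2 (n : ℕ) (hn : 2 ≤ n) (a b θ : ℝ) (ha : 0 < a) (hb : 0 < b)
    (hθ : 0 < θ) (hθ' : θ < Real.pi / 2)
    (μ ν : (miura 2 n a b θ).ValidMV)
    (hμ : ((miura 2 n a b θ).OFG.neighborSet μ).ncard = 2)
    (hν : ((miura 2 n a b θ).OFG.neighborSet ν).ncard = 2)
    (hopp : (miura 2 n a b θ).Opposite μ ν) :
    (miura 2 n a b θ).OFG.Reachable μ ν ∧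
      (miura 2 n a b θ).OFG.dist μ ν = ⌈(n : ℝ) ^ 2 / 2⌉₊ := by
  obtain ⟨h, r, s, H, c, hh⟩ := exists_height_eq_of_ncard_neighborSet_eq_two hn ha hb hθ hθ' μ hμ
  have hneg : ν.1 = -μ.1 := funext hopp.2
  have hs : (s : ℤ) * s = 1 := by rw [← Units.val_mul, Int.units_mul_self, Units.val_one]
  have K : ∀ d, IsHeight ν.1 fun f => -h f + d := fun d => by
    rw [hneg]
    exact H.neg_add_const d
  have diff : ∀ d f, |-h f + d - h f| = |2 * h f - d| := fun d f => by
    rw [← abs_neg]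
    congr 1
    ring
  rw [Nat.ceil_sq_div_two]
  -- Of the heights of `ν`, the one closest to `h` has its constant at the median of `2 h`; the
  -- even representative `2 (c + s ⌊n / 2⌋)` keeps the heights congruent modulo `2`.
  obtain ⟨w, hw⟩ := exists_walk_of_isHeight ha hb hθ hθ' ((n ^ 2 + 1) / 2) μ ν h _ H
    (K (2 * (c + s * (n / 2 : ℕ)))) (fun f => ⟨c + s * (n / 2 : ℕ) - h f, by ring⟩) (by
      simp only [diff]
      rw [sum_faces_abs hh, ← sum_range_abs_eq]
      have : s * (2 * (c + s * (n / 2 : ℕ)) - 2 * c) = 2 * ((n / 2 : ℕ) : ℤ) := by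
        linear_combination 2 * ((n / 2 : ℕ) : ℤ) * hs
      rw [this])
  refine ⟨⟨w⟩, le_antisymm ((SimpleGraph.dist_le w).trans hw) ?_⟩
  -- The lower bound does not need the congruence modulo `2`: it holds for every height of `ν`.
  obtain ⟨w', hw'⟩ := SimpleGraph.Reachable.exists_walk_length_eq_dist ⟨w⟩
  rw [← hw']
  obtain ⟨k, Kk, hk⟩ := exists_isHeight_of_walk ha hb hθ hθ' w' H
  obtain ⟨d, hd⟩ := (K 0).exists_eq_add_const (by omega) Kk
  have := le_sum_range_abs n (s * (d - 2 * c))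
  rw [← sum_faces_abs hh] at this
  simp only [hd, add_zero, diff] at hk
  omega
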